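/- Let $K$ be a differential field of differential functions $f(x,u,u_1,u_2,\dots)$, where $u_i=\partial^i u/\partial x^i$ and $u_0=u$: a field of characteristic $0$ containing $x$ and all $u_i$, with commuting derivations $\partial/\partial x$, $\partial/\partial u_i$ acting on $x$ and the $u_j$ in the usual way, such that each $f\in K$ satisfies $\partial f/\partial u_i\neq 0$ for finitely many $i$ only (for example the field of rational functions in $x,u,u_1,u_2,\dots$). Put $$D_x=\frac{\partial}{\partial x}+\sum_{i\ge0}u_{i+1}\frac{\partial}{\partial u_i},\qquad F=u^2(1+u_2),\qquad D_t=\sum_{i\ge 0}D_x^i(F)\frac{\partial}{\partial u_i},\qquad D_F=\sum_{i\ge0}\frac{\partial F}{\partial u_i}D_x^i .$$ A function $Q\in K$ is a generalized symmetry of the equation $u_t=F$, that is of $u_t=u^2(1+u_{xx})$, if $(D_t-D_F)Q=0$. The function $Q$ is of order $n$ if $\partial Q/\partial u_n\ne0$ and $\partial Q/\partial u_m=0$ for all $m>n$. Consider the operator $$\mathcal P=u\,D_x+\frac x2+u^2(1+u_2)\,D_x^{-1}\cdot\frac1{u^2}.$$ It is a formal series in $D_x$ over $K$; formal series $\sum_{j\le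 m}r_jD_x^j$ are multiplied by $aD_x^j\cdot bD_x^k=\sum_{i\ge0}\binom ji a\,D_x^i(b)\,D_x^{j+k-i}$. For $Q,Q'\in K$ write $Q'=\mathcal P Q$ if $Q'=u D_xQ+\frac x2 Q+u^2(1+u_2)h$ for some $h\in K$ with $D_xh=Q/u^2$ (so $\mathcal PQ$, when it exists, is determined up to the choice of $h$). Put $$C_4=u^2(1+u_2),\qquad C_3=\tfrac12u^2\bigl(6u_1(1+u_2)+2uu_3+3x(1+u_2)\bigr).$$ Then: 1. The Fréchet derivative $D_\Delta=D_t-D_F$ of the equation is $D_t-u^2D_x^2-2u(1+u_2)$, and $D_\Delta\cdot\mathcal P=\mathcal P\cdot D_\Delta$ as operators, where $D_t\cdot B=D_t(B)+B\cdot D_t$ for a formal series $B$ and $D_t(B)$ is taken coefficientwise. Equivalently, $\mathcal P$ is a formal recursion operator: $D_t(\mathcal P)-[D_F,\mathcal P]=0$. 2. $\mathcal P$ is a recursion operator with root $C_4$: if $Q_1=C_4,\ Q_2,\dots,Q_n$ is any finite sequence in $K$ with $Q_{j+1}=\mathcal PQ_j$, then $Q_n$ is a generalized symmetry of the equation, and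 there is $Q_{n+1}\in K$ with $Q_{n+1}=\mathcal PQ_n$. In particular there is an infinite sequence of generalized symmetries $Q_1=C_4$, $Q_{j+1}=\mathcal PQ_j$. 3. These symmetries are of strictly increasing order: in every such sequence $Q_j$ is of order $j+1$. 4. $\mathcal PC_4=C_3$, where $C_4$ is of order $2$ and $C_3$ is of order $3$. -/

import Mathlib

noncomputable section

/-- A differential field of differential functions `f(x, u, u₁, u₂, …)`: a field `K` containing the
coordinates `x` and `uᵢ = ∂ⁱu/∂xⁱ`, with the partial derivatives `∂/∂x` and `∂/∂uᵢ`, each element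
depending on finitely many of the `uᵢ` only. -/
class JetField (K : Type*) [Field K] where
  /-- the independent variable -/
  x : K
  /-- the jet coordinates, `u 0 = u` -/
  u : ℕ → K
  /-- `∂/∂x` -/
  dx : Derivation ℤ K K
  /-- `∂/∂uᵢ` -/
  du : ℕ → Derivation ℤ K K
  dx_x : dx x = 1
  dx_u : ∀ i, dx (u i) = 0
  du_x : ∀ i, du i x = 0
  du_u : ∀ i j, du i (u j) = if i = j then 1 else 0
  dx_du_comm : ∀ i f, dx (du i f) = du i (dx f)
  du_du_comm : ∀ i j f, du i (du j f) = du j (du i f)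
  finite_du : ∀ f, {i | du i f ≠ 0}.Finite

namespace JetField

/-! ### The field of rational functions in `x, u, u₁, u₂, …` is such a field -/

section Rational

/-- Polynomials in `x` (the variable `none`) and `uᵢ` (the variables `some i`). -/
abbrev JetPoly : Type := MvPolynomial (Option ℕ) ℝ

variable (L : Type*) [Field L] [Algebra JetPoly L]

/-- The homomorphism `p ↦ p + ε ∂p/∂xₛ`. -/
def ratDual (s : Option ℕ) : JetPoly →+* TrivSqZeroExt L L where
  toFun p := (algebraMap JetPoly L p, algebraMap JetPoly L (MvPolynomial.pderiv s p))
  map_one' := TrivSqZeroExt.ext (map_one _) <| by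
    change algebraMap JetPoly L (MvPolynomial.pderiv s 1) = 0
    rw [Derivation.map_one_eq_zero, map_zero]
  map_zero' := TrivSqZeroExt.ext (map_zero _) <| by
    change algebraMap JetPoly L (MvPolynomial.pderiv s 0) = 0
    rw [map_zero, map_zero]
  map_add' p q := TrivSqZeroExt.ext (map_add _ p q) <| by
    change algebraMap JetPoly L (MvPolynomial.pderiv s (p + q)) =
      algebraMap JetPoly L (MvPolynomial.pderiv s p) +
        algebraMap JetPoly L (MvPolynomial.pderiv s q)
    rw [map_add, map_add]
  map_mul' p q := TrivSqZeroExt.ext (map_mul _ p q) <| by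
    change algebraMap JetPoly L (MvPolynomial.pderiv s (p * q)) =
      algebraMap JetPoly L p * algebraMap JetPoly L (MvPolynomial.pderiv s q) +
        algebraMap JetPoly L (MvPolynomial.pderiv s p) * algebraMap JetPoly L q
    rw [Derivation.leibniz, smul_eq_mul, smul_eq_mul, map_add, map_mul, map_mul]
    ring

variable [IsFractionRing JetPoly L]

theorem ratDual_isUnit (s : Option ℕ) (p : nonZeroDivisors JetPoly) : IsUnit (ratDual L s p) := by
  rw [TrivSqZeroExt.isUnit_iff_isUnit_fst]
  have h : algebraMap JetPoly L p ≠ 0 :=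
    IsFractionRing.to_map_ne_zero_of_mem_nonZeroDivisors p.2
  exact h.isUnit

/-- Its extension to rational functions. -/
def ratLift (s : Option ℕ) : L →+* TrivSqZeroExt L L :=
  IsLocalization.lift (M := nonZeroDivisors JetPoly) (ratDual_isUnit L s)

theorem ratLift_algebraMap (s : Option ℕ) (p : JetPoly) :
    ratLift L s (algebraMap JetPoly L p) = ratDual L s p :=
  IsLocalization.lift_eq _ _

theorem ratLift_fst (s : Option ℕ) (f : L) : (ratLift L s f).fst = f := by
  have h : (TrivSqZeroExt.fstHom L L L : _ →+* L).comp (ratLift L s) = RingHom.id L := by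
    apply IsLocalization.ringHom_ext (nonZeroDivisors JetPoly)
    refine RingHom.ext fun p => ?_
    change (ratLift L s (algebraMap JetPoly L p)).fst = algebraMap JetPoly L p
    rw [ratLift_algebraMap]
    rfl
  exact congrArg (fun g => g f) h

/-- The partial derivatives of rational functions. -/
def ratPderiv (s : Option ℕ) : Derivation ℤ L L :=
  Derivation.mk' (AddMonoidHom.mk' (fun f => (ratLift L s f).snd) (by simp)).toIntLinearMap
    fun a b => by simp [TrivSqZeroExt.snd_mul, ratLift_fst, mul_comm]

theorem ratPderiv_algebraMap (s : Option ℕ) (p : JetPoly) :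
    ratPderiv L s (algebraMap JetPoly L p) =
      algebraMap JetPoly L (MvPolynomial.pderiv s p) := by
  change (ratLift L s (algebraMap JetPoly L p)).snd = _
  rw [ratLift_algebraMap]
  rfl

theorem ratDeriv_ext (d e : Derivation ℤ L L)
    (h : ∀ p, d (algebraMap JetPoly L p) = e (algebraMap JetPoly L p)) (f : L) :
    d f = e f := by
  obtain ⟨p, q, hq, rfl⟩ := IsFractionRing.div_surjective (A := JetPoly) f
  rw [Derivation.leibniz_div, Derivation.leibniz_div, h, h]

theorem ratPderiv_comm (s t : Option ℕ) (f : L) :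
    ratPderiv L s (ratPderiv L t f) = ratPderiv L t (ratPderiv L s f) := by
  have := ratDeriv_ext L ⁅ratPderiv L s, ratPderiv L t⁆ 0 (fun p => by
    have h : ⁅MvPolynomial.pderiv (R := ℝ) s, MvPolynomial.pderiv (R := ℝ) t⁆ = 0 := by
      apply MvPolynomial.derivation_ext
      intro i
      by_cases h1 : s = i <;> by_cases h2 : t = i <;>
        simp [Derivation.commutator_apply, MvPolynomial.pderiv_X, h1, h2]
    have h' := congrArg (fun d => d p) h
    simp only [Derivation.commutator_apply, Derivation.zero_apply] at h'
    simp only [Derivation.commutator_apply, ratPderiv_algebraMap, ← map_sub, h', map_zero,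
      Derivation.zero_apply]) f
  rw [Derivation.commutator_apply, Derivation.zero_apply, sub_eq_zero] at this
  exact this

/-- The field of rational functions in `x, u, u₁, u₂, …`. -/
abbrev ratJetField : JetField L where
  x := algebraMap JetPoly L (MvPolynomial.X none)
  u i := algebraMap JetPoly L (MvPolynomial.X (some i))
  dx := ratPderiv L none
  du i := ratPderiv L (some i)
  dx_x := by simp [ratPderiv_algebraMap]
  dx_u i := by simp [ratPderiv_algebraMap, MvPolynomial.pderiv_X]
  du_x i := by simp [ratPderiv_algebraMap, MvPolynomial.pderiv_X]
  du_u i j := by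
    by_cases h : i = j
    · subst h; simp [ratPderiv_algebraMap]
    · rw [ratPderiv_algebraMap, MvPolynomial.pderiv_X_of_ne (by simpa using Ne.symm h)]
      simp [h]
  dx_du_comm _ _ := ratPderiv_comm _ _ _ _
  du_du_comm _ _ _ := ratPderiv_comm _ _ _ _
  finite_du f := by
    obtain ⟨p, q, hq, rfl⟩ := IsFractionRing.div_surjective (A := JetPoly) f
    refine (((p.vars ∪ q.vars).finite_toSet).preimage
      (Option.some_injective ℕ).injOn).subset fun i hi => ?_
    by_contra hc
    simp only [Finset.coe_union, Set.mem_preimage, Set.mem_union, Finset.mem_coe, not_or] at hc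
    apply hi
    rw [Derivation.leibniz_div, ratPderiv_algebraMap, ratPderiv_algebraMap,
      MvPolynomial.pderiv_eq_zero_of_notMem_vars hc.1,
      MvPolynomial.pderiv_eq_zero_of_notMem_vars hc.2]
    simp

instance : JetField (FractionRing JetPoly) := ratJetField _

end Rational

variable {K : Type*} [Field K] [JetField K]

/-! ### Total derivatives, prolongations, Fréchet derivatives, order -/

/-- The total derivative `D_x = ∂/∂x + ∑ᵢ uᵢ₊₁ ∂/∂uᵢ`. -/
def Dx (f : K) : K := dx f + ∑ᶠ i : ℕ, u (i + 1) * du i f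

/-- The prolonged evolutionary vector field `P^Q = ∑ᵢ D_xⁱ(Q) ∂/∂uᵢ`. On functions of
`x, u, u₁, …` the operator `P^F` is the total derivative `D_t` along the solutions of `u_t = F`. -/
def prolong (Q f : K) : K := ∑ᶠ i : ℕ, Dx^[i] Q * du i f

/-- The Fréchet derivative `D_H = ∑ᵢ ∂H/∂uᵢ D_xⁱ`, acting on functions. -/
def frechetApply (H v : K) : K := ∑ᶠ i : ℕ, du i H * Dx^[i] v

/-- `Q` is (the characteristic of) a generalized symmetry of `u_t = F`: `(D_t - D_F) Q = 0`. -/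
def IsSymmetry (F Q : K) : Prop := prolong F Q - frechetApply F Q = 0

/-- `f` is of order `n`: it depends on `uₙ`, but not on `uₘ` for `m > n`. -/
def HasOrder (f : K) (n : ℕ) : Prop := du n f ≠ 0 ∧ ∀ m, n < m → du m f = 0

theorem Dx_zero : Dx (0 : K) = 0 := by simp [Dx]

theorem prolong_zero (Q : K) : prolong Q (0 : K) = 0 := by simp [prolong]

theorem iterate_Dx_zero (i : ℕ) : Dx^[i] (0 : K) = 0 :=
  Function.iterate_fixed Dx_zero i

/-! ### Formal pseudo-differential operators -/

/-- The coefficient families `(rⱼ)` that vanish for all large `j`. -/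
def boundedAbove (K : Type*) [Field K] : AddSubgroup (ℤ → K) where
  carrier := {r | ∃ m : ℤ, ∀ j, m < j → r j = 0}
  zero_mem' := ⟨0, fun _ _ => rfl⟩
  add_mem' := by
    rintro r s ⟨m, hm⟩ ⟨n, hn⟩
    refine ⟨max m n, fun j hj => ?_⟩
    simp [hm j (lt_of_le_of_lt (le_max_left _ _) hj), hn j (lt_of_le_of_lt (le_max_right _ _) hj)]
  neg_mem' := by
    rintro r ⟨m, hm⟩
    exact ⟨m, fun j hj => by simp [hm j hj]⟩

/-- The formal series `∑_{j ≤ m} rⱼ D_xʲ`. -/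
def PsiDO (K : Type*) [Field K] : Type _ := boundedAbove K

namespace PsiDO

instance : AddCommGroup (PsiDO K) := inferInstanceAs (AddCommGroup (boundedAbove K))

/-- The coefficient of `D_xʲ`. -/
def coeff (S : PsiDO K) (j : ℤ) : K := S.1 j

/-- The operator `f D_xʲ`. -/
def single (j : ℤ) (f : K) : PsiDO K :=
  ⟨fun k => if k = j then f else 0, j, fun k hk => by simp [hk.ne']⟩

/-- The composition of formal series, determined by
`a D_xʲ ∘ b D_xᵏ = ∑_{i ≥ 0} binom(j, i) a D_xⁱ(b) D_x^{j+k-i}`, `j, k ∈ ℤ`.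
For each coefficient only finitely many terms are nonzero (`finite_support_mul`). -/
def mulCoeff (A B : PsiDO K) (n : ℤ) : K :=
  ∑ᶠ p : ℤ × ℕ, (Ring.choose p.1 p.2 : ℤ) • (A.coeff p.1 * Dx^[p.2] (B.coeff (n - p.1 + p.2)))

theorem finite_support_mul (A B : PsiDO K) (n : ℤ) : (Function.support fun p : ℤ × ℕ =>
    (Ring.choose p.1 p.2 : ℤ) •
      (A.coeff p.1 * Dx^[p.2] (B.coeff (n - p.1 + p.2)))).Finite := by
  obtain ⟨a, ha⟩ := A.2
  obtain ⟨b, hb⟩ := B.2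
  refine ((Set.finite_Icc (n - b) a).prod (Set.finite_Iic (b - n + a).toNat)).subset ?_
  rintro ⟨j, i⟩ hp
  have h1 : j ≤ a := by
    by_contra hc
    exact hp (by simp [coeff, ha j (not_le.mp hc)])
  have h2 : n - j + i ≤ b := by
    by_contra hc
    exact hp (by simp [coeff, hb _ (not_le.mp hc), iterate_Dx_zero])
  simp only [Set.mem_prod, Set.mem_Icc, Set.mem_Iic]
  omega

instance : Mul (PsiDO K) where
  mul A B := ⟨mulCoeff A B, by
    obtain ⟨a, ha⟩ := A.2
    obtain ⟨b, hb⟩ := B.2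
    refine ⟨a + b, fun n hn => ?_⟩
    rw [mulCoeff, ← finsum_zero (α := ℤ × ℕ)]
    refine finsum_congr fun p => ?_
    rcases lt_or_ge a p.1 with h | h
    · simp [coeff, ha _ h]
    · have : b < n - p.1 + p.2 := by omega
      simp [coeff, hb _ this, iterate_Dx_zero]⟩

/-- The Fréchet derivative `D_H = ∑ᵢ ∂H/∂uᵢ D_xⁱ` as a formal series. -/
def frechet (H : K) : PsiDO K :=
  ⟨fun j => if 0 ≤ j then du j.toNat H else 0, by
    obtain ⟨m, hm⟩ := (finite_du H).bddAbove
    refine ⟨m, fun j hj => ?_⟩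
    change (if 0 ≤ j then du j.toNat H else 0) = 0
    rw [if_pos (by omega)]
    by_contra hc
    have := hm hc
    omega⟩

/-- `P^Q` applied to a formal series coefficient by coefficient. -/
def prolong (Q : K) (S : PsiDO K) : PsiDO K :=
  ⟨fun j => JetField.prolong Q (S.coeff j), by
    obtain ⟨m, hm⟩ := S.2
    exact ⟨m, fun j hj => by simp [coeff, hm j hj, prolong_zero]⟩⟩

/-- `S` is a formal recursion operator of `u_t = F`: `P^F(S) - [D_F, S] = 0`. -/
def IsFormalRecursionOperator (F : K) (S : PsiDO K) : Prop :=
  prolong F S - (frechet F * S - S * frechet F) = 0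

end PsiDO

/-- Polynomials `∑ₗ Aₗ D_tˡ` in `D_t` with formal series in `D_x` as coefficients, on the solutions
of `u_t = F`. -/
def EvolOp (_F : K) : Type _ := ℕ →₀ PsiDO K

namespace EvolOp

variable {F : K}

instance : AddCommGroup (EvolOp F) := inferInstanceAs (AddCommGroup (ℕ →₀ PsiDO K))

/-- The operator `A D_tˡ`. -/
def single (F : K) (l : ℕ) (A : PsiDO K) : EvolOp F := Finsupp.single l A

/-- The composition of operators, determined by `D_t ∘ B = D_t(B) + B ∘ D_t`, that is by
`A D_tˡ ∘ B D_tᵏ = ∑_{p ≤ l} binom(l, p) A D_tᵖ(B) D_t^{l+k-p}`, where `D_t = P^F`. -/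
instance : Mul (EvolOp F) where
  mul A B := Finsupp.sum A fun l a => Finsupp.sum B fun k b =>
    ∑ p ∈ Finset.range (l + 1),
      single F (l + k - p) (l.choose p • (a * (PsiDO.prolong F)^[p] b))

/-- `D_t`. -/
def Dt (F : K) : EvolOp F := single F 1 (PsiDO.single 0 1)

/-- A formal series in `D_x` as an operator. -/
def ofPsiDO (F : K) (S : PsiDO K) : EvolOp F := single F 0 S

/-- The Fréchet derivative `D_Δ = D_t - D_F` of the equation `Δ = u_t - F = 0`. -/
def linearization (F : K) : EvolOp F := Dt F - ofPsiDO F (PsiDO.frechet F)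

end EvolOp

/-! ### Recursion operators with a nonlocal term -/

variable (K) in
/-- The operator `c₁ D_x + c₀ + a D_x⁻¹ · b`. -/
structure NonlocalOp where
  c₁ : K
  c₀ : K
  a : K
  b : K

namespace NonlocalOp

/-- The operator as a formal series in `D_x`. -/
def toPsiDO (R : NonlocalOp K) : PsiDO K :=
  PsiDO.single 1 R.c₁ + PsiDO.single 0 R.c₀
    + PsiDO.single 0 R.a * PsiDO.single (-1) 1 * PsiDO.single 0 R.b

/-- `Q' = R Q`, where `D_x⁻¹ (b Q)` may be any differential function `h` with `D_x h = b Q`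
(in particular there has to be one). -/
def Applies (R : NonlocalOp K) (Q Q' : K) : Prop :=
  ∃ h : K, Dx h = R.b * Q ∧ Q' = R.c₁ * Dx Q + R.c₀ * Q + R.a * h

/-- `Q` is an `n`-th iterate `Rⁿ Q₁`. -/
inductive IsIterate (R : NonlocalOp K) (Q₁ : K) : ℕ → K → Prop
  | root : IsIterate R Q₁ 0 Q₁
  | step {n : ℕ} {Q Q' : K} : IsIterate R Q₁ n Q → R.Applies Q Q' → IsIterate R Q₁ (n + 1) Q'

/-- `R` is a recursion operator of `u_t = F` with root `Q₁`: starting from `Q₁`, the operator can be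
applied again and again, and everything that it produces is a generalized symmetry of `u_t = F`. -/
def IsRecursionOperator (F : K) (R : NonlocalOp K) (Q₁ : K) : Prop :=
  ∀ n Q, R.IsIterate Q₁ n Q → IsSymmetry F Q ∧ ∃ Q', R.Applies Q Q'

end NonlocalOp

variable (K)

/-- The right-hand side `F = u² (1 + u₂)` of the equation. -/
def rhs : K := u 0 ^ 2 * (1 + u 2)

/-- The operator `P = u D_x + x/2 + u² (1 + u₂) D_x⁻¹ · (1/u²)`. -/
def recOp : NonlocalOp K where
  c₁ := u 0
  c₀ := x / 2
  a := u 0 ^ 2 * (1 + u 2)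
  b := 1 / u 0 ^ 2

/-- `C₃ = ½ u² (6 u₁ (1 + u₂) + 2 u u₃ + 3 x (1 + u₂))`. -/
def C₃ : K :=
  1 / 2 * u 0 ^ 2 * (6 * u 1 * (1 + u 2) + 2 * u 0 * u 3 + 3 * x * (1 + u 2))

/-- `C₄ = u² (1 + u₂)`. -/
def C₄ : K := u 0 ^ 2 * (1 + u 2)

end JetField

end

/-!
Put `T = u² D_x²` and `M = u D_x + x/2`, so that `D_F = T + 2u(1 + u₂)` and `[T, M] = F D_x`. Along
the solutions, `D_t(T) = D_F T - T T`, that is `(D_t - D_F) T = T (D_t - T)`, and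
`D_t(M) = F D_x = [T, M]`, that is `M` commutes with `D_t - T`. Since `P T = M T + F D_x = T M`, the
operator `P = T M T⁻¹` commutes with `D_t - D_F`.

The same identities give the symmetries. If a function `B` solves `D_t B = T B`, then `T B` is a
symmetry. The root is `C₄ = T B₀` with `B₀ = u + x²/2`, and any value of `P (T B)` is
`T (M B + c B₀)`, where `c = h - D_x B` is the constant of integration. As `M` raises the order by
one, nothing obstructs the next step, and the orders increase.
-/

noncomputable section

namespace JetField

section DifferentialFunctions

variable {K : Type*} [Field K] [JetField K]

/-! ### Vector fields on jet space -/

theorem finite_support_mul_du (w : ℕ → K) (f : K) :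
    (Function.support fun i => w i * du i f).Finite :=
  (finite_du f).subset fun _ => right_ne_zero_of_mul

/-- The vector field `∑ᵢ wᵢ ∂/∂uᵢ` on jet space. -/
def vectorField (w : ℕ → K) : Derivation ℤ K K :=
  Derivation.mk'
    (AddMonoidHom.mk' (fun f => ∑ᶠ i, w i * du i f) fun f g => by
      simp only [map_add, mul_add]
      exact finsum_add_distrib (finite_support_mul_du w f)
        (finite_support_mul_du w g)).toIntLinearMap
    fun f g => by
      change ∑ᶠ i, w i * du i (f * g) = f * (∑ᶠ i, w i * du i g) + g * ∑ᶠ i, w i * du i f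
      rw [mul_finsum' _ _ (finite_support_mul_du w g), mul_finsum' _ _ (finite_support_mul_du w f),
        ← finsum_add_distrib
          ((finite_support_mul_du w g).subset fun i hi h => hi (by simp [h]))
          ((finite_support_mul_du w f).subset fun i hi h => hi (by simp [h]))]
      exact finsum_congr fun i => by
        rw [Derivation.leibniz, smul_eq_mul, smul_eq_mul]
        ring

theorem vectorField_apply (w : ℕ → K) (f : K) : vectorField w f = ∑ᶠ i, w i * du i f := rfl

theorem vectorField_apply_eq_sum {s : Finset ℕ} (w : ℕ → K) {f : K} (hs : ∀ i ∉ s, du i f = 0) :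
    vectorField w f = ∑ i ∈ s, w i * du i f :=
  finsum_eq_sum_of_support_subset _ fun i hi => by
    by_contra his
    exact hi (by simp only [hs i his, mul_zero])

theorem vectorField_x (w : ℕ → K) : vectorField w x = 0 := by
  simp [vectorField_apply, du_x]

theorem vectorField_u (w : ℕ → K) (j : ℕ) : vectorField w (u j) = w j := by
  rw [vectorField_apply, finsum_eq_single _ j fun i hi => by simp [du_u, hi]]
  simp [du_u]

theorem vectorField_sub (v w : ℕ → K) :
    vectorField (fun i => v i - w i) = vectorField v - vectorField w := by
  ext f
  simp only [vectorField_apply, Derivation.sub_apply, sub_mul]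
  exact finsum_sub_distrib (finite_support_mul_du v f) (finite_support_mul_du w f)

theorem vectorField_single (k : ℕ) (f : K) : vectorField (Pi.single k 1) f = du k f := by
  rw [vectorField_apply, finsum_eq_single _ k fun i hi => by simp [hi]]
  simp

theorem map_vectorField (d : Derivation ℤ K K) (w : ℕ → K) (f : K) :
    d (vectorField w f) = vectorField (fun i => d (w i)) f + ∑ᶠ i, w i * d (du i f) := by
  rw [vectorField_apply, vectorField_apply, ← finsum_add_distrib (finite_support_mul_du _ f)
    ((finite_du f).subset fun i hi h => hi (by simp [h]))]
  refine (AddMonoidHom.map_finsum (d : K →+ K) (finite_support_mul_du w f)).trans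
    (finsum_congr fun i => ?_)
  change d (w i * du i f) = _
  rw [Derivation.leibniz, smul_eq_mul, smul_eq_mul]
  ring

theorem finsum_mul_vectorField_du_comm (v w : ℕ → K) (f : K) :
    ∑ᶠ i, w i * vectorField v (du i f) = ∑ᶠ j, v j * vectorField w (du j f) := by
  let s := (finite_du f).toFinset
  have hs : ∀ i ∉ s, du i f = 0 := fun i hi => by simpa [s] using hi
  have hss : ∀ i, ∀ j ∉ s, du j (du i f) = 0 := fun i j hj => by
    rw [du_du_comm, hs j hj, map_zero]
  have expand : ∀ a b : ℕ → K, ∑ᶠ i, a i * vectorField b (du i f) =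
      ∑ i ∈ s, ∑ j ∈ s, a i * (b j * du j (du i f)) := fun a b => by
    rw [finsum_eq_sum_of_support_subset (s := s) _ fun i hi => by
      by_contra his
      exact hi (by simp only [hs i his, map_zero, mul_zero])]
    exact Finset.sum_congr rfl fun i _ => by
      rw [vectorField_apply_eq_sum b (hss i), Finset.mul_sum]
  rw [expand, expand, Finset.sum_comm]
  exact Finset.sum_congr rfl fun j _ => Finset.sum_congr rfl fun i _ => by
    rw [du_du_comm i j, mul_left_comm]

/-! ### Total derivative and prolongation -/

variable (K) in
/-- The total derivative `Dx` as a derivation. -/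
def totalDerivation : Derivation ℤ K K := dx + vectorField fun i => u (i + 1)

theorem coe_totalDerivation : ⇑(totalDerivation K) = Dx := rfl

/-- The prolonged evolutionary vector field `prolong Q` as a derivation. -/
def prolongation (Q : K) : Derivation ℤ K K := vectorField fun i => Dx^[i] Q

theorem coe_prolongation (Q : K) : ⇑(prolongation Q) = prolong Q := rfl

theorem totalDerivation_x : totalDerivation K x = 1 := by
  rw [totalDerivation, Derivation.add_apply, dx_x, vectorField_x, add_zero]

theorem totalDerivation_u (i : ℕ) : totalDerivation K (u i) = u (i + 1) := by
  rw [totalDerivation, Derivation.add_apply, dx_u, vectorField_u, zero_add]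

theorem prolongation_x (Q : K) : prolongation Q x = 0 := vectorField_x _

theorem prolongation_u (Q : K) (i : ℕ) : prolongation Q (u i) = Dx^[i] Q := vectorField_u _ i

theorem vectorField_Dx (w : ℕ → K) (f : K) :
    vectorField w (Dx f) =
      Dx (vectorField w f) + vectorField (fun i => w (i + 1) - Dx (w i)) f := by
  have h₁ : vectorField w (Dx f) = vectorField w (dx f) +
      (vectorField (fun i => w (i + 1)) f + ∑ᶠ i, u (i + 1) * vectorField w (du i f)) := by
    rw [← coe_totalDerivation, totalDerivation, Derivation.add_apply, map_add,
      map_vectorField (vectorField w)]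
    simp only [vectorField_u]
  have h₂ : Dx (vectorField w f) = vectorField (fun i => Dx (w i)) f +
      (vectorField w (dx f) + ∑ᶠ i, w i * vectorField (fun j => u (j + 1)) (du i f)) := by
    rw [← coe_totalDerivation, map_vectorField, vectorField_apply w (dx f),
      ← finsum_add_distrib (finite_support_mul_du w (dx f))
        ((finite_du f).subset fun i hi h => hi (by simp [h]))]
    simp only [totalDerivation, Derivation.add_apply, dx_du_comm, mul_add]
  rw [h₁, h₂, finsum_mul_vectorField_du_comm w, vectorField_sub, Derivation.sub_apply]
  ring

theorem du_succ_Dx (k : ℕ) (f : K) : du (k + 1) (Dx f) = Dx (du (k + 1) f) + du k f := by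
  rw [← vectorField_single (k + 1), vectorField_Dx, vectorField_single, ← vectorField_single k]
  congr 3 with i
  rcases eq_or_ne i (k + 1) with rfl | hi
  · simp [← coe_totalDerivation]
  · simp [hi, Dx_zero, Pi.single_apply]

theorem prolong_Dx (Q f : K) : prolong Q (Dx f) = Dx (prolong Q f) := by
  rw [← coe_prolongation, prolongation, vectorField_Dx]
  simp [vectorField_apply, Function.iterate_succ_apply' Dx]

theorem u_zero_ne_zero : (u 0 : K) ≠ 0 := fun h => by
  simpa [h] using du_u (K := K) 0 0

/-! ### Order -/

variable (K) in
/-- The field of functions of order less than `n`, that is of functions of `x` and the `uᵢ` with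
`i < n` only. For `n = 0` these are the functions of `x` alone. -/
def orderLT (n : ℕ) : Subfield K where
  carrier := {f | ∀ m, n ≤ m → du m f = 0}
  mul_mem' hf hg m hm := by simp [Derivation.leibniz, hf m hm, hg m hm]
  one_mem' m _ := (du m).map_one_eq_zero
  add_mem' hf hg m hm := by rw [map_add, hf m hm, hg m hm, add_zero]
  zero_mem' m _ := map_zero (du m)
  neg_mem' hf m hm := by rw [map_neg, hf m hm, neg_zero]
  inv_mem' f hf m hm := by rw [Derivation.leibniz_inv, hf m hm, smul_zero]

theorem mem_orderLT {f : K} {n : ℕ} : f ∈ orderLT K n ↔ ∀ m, n ≤ m → du m f = 0 := Iff.rfl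

theorem x_mem_orderLT (n : ℕ) : x ∈ orderLT K n := fun m _ => du_x m

theorem u_mem_orderLT {i n : ℕ} (h : i < n) : u i ∈ orderLT K n := fun m hm => by
  rw [du_u, if_neg (by omega)]

theorem orderLT_mono {m n : ℕ} (h : m ≤ n) : orderLT K m ≤ orderLT K n :=
  fun _ hf k hk => hf k (h.trans hk)

namespace HasOrder

variable {f g : K} {n : ℕ}

theorem mem_orderLT {m : ℕ} (hf : HasOrder f n) (h : n < m) : f ∈ orderLT K m :=
  fun k hk => hf.2 k (h.trans_le hk)

theorem add (hf : HasOrder f n) (hg : g ∈ orderLT K n) : HasOrder (f + g) n :=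
  ⟨by rw [map_add, hg n le_rfl, add_zero]; exact hf.1,
    fun m hm => by rw [map_add, hf.2 m hm, hg m hm.le, add_zero]⟩

theorem mul_left (hf : HasOrder f n) (hg : g ∈ orderLT K n) (hg₀ : g ≠ 0) : HasOrder (g * f) n :=
  ⟨by simpa [Derivation.leibniz, hg n le_rfl] using ⟨hg₀, hf.1⟩,
    fun m hm => by simp [Derivation.leibniz, hf.2 m hm, hg m hm.le]⟩

theorem Dx (hf : HasOrder f n) : HasOrder (Dx f) (n + 1) := by
  refine ⟨?_, fun m hm => ?_⟩
  · rw [du_succ_Dx, hf.2 _ (Nat.lt_succ_self n), Dx_zero, zero_add]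
    exact hf.1
  · obtain ⟨j, rfl⟩ := Nat.exists_eq_add_one_of_ne_zero (Nat.ne_zero_of_lt hm)
    rw [du_succ_Dx, hf.2 _ (by omega), hf.2 _ (by omega), Dx_zero, add_zero]

end HasOrder

theorem exists_hasOrder {f : K} (hf : f ∉ orderLT K 0) : ∃ n, HasOrder f n := by
  obtain ⟨i, hi⟩ : ∃ i, du i f ≠ 0 := by simpa [mem_orderLT] using hf
  obtain ⟨n, hn, hmax⟩ := (finite_du f).exists_maximal ⟨i, hi⟩
  refine ⟨n, hn, fun m hm => ?_⟩
  by_contra h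
  exact hm.not_ge (hmax h hm.le)

theorem mem_orderLT_zero_of_Dx_eq_zero {c : K} (hc : Dx c = 0) : c ∈ orderLT K 0 := by
  by_contra h
  obtain ⟨n, hn⟩ := exists_hasOrder h
  exact hn.Dx.1 (by rw [hc, map_zero])

theorem prolong_eq_zero_of_mem_orderLT_zero (Q : K) {f : K} (hf : f ∈ orderLT K 0) :
    prolong Q f = 0 := by
  simp [prolong, hf _ (Nat.zero_le _)]

end DifferentialFunctions

/-! ### The ring of formal series in `D_x` -/

theorem finsum_comp_of_support_subset_range {α β M : Type*} [AddCommMonoid M] {e : α → β}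
    {g : β → M} (he : Function.Injective e) (hg : Function.support g ⊆ Set.range e) :
    ∑ᶠ a, g (e a) = ∑ᶠ b, g b := by
  rw [← finsum_mem_range he, ← finsum_mem_inter_support, Set.inter_eq_right.mpr hg,
    finsum_mem_support]

theorem finsum_choose_succ_smul {M : Type*} [AddCommGroup M] {t : ℤ × ℕ → M}
    (ht : (Function.support t).Finite) :
    ∑ᶠ p : ℤ × ℕ, Ring.choose (p.1 + 1) p.2 • t p =
      ∑ᶠ p : ℤ × ℕ, Ring.choose p.1 p.2 • t p +
        ∑ᶠ p : ℤ × ℕ, Ring.choose p.1 p.2 • t (p.1, p.2 + 1) := by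
  have shift : ∑ᶠ p : ℤ × ℕ, Ring.choose p.1 p.2 • t (p.1, p.2 + 1) =
      ∑ᶠ p : ℤ × ℕ, (Ring.choose (p.1 + 1) p.2 - Ring.choose p.1 p.2) • t p := by
    rw [← finsum_comp_of_support_subset_range (e := Prod.map id (· + 1))
      (g := fun p => (Ring.choose (p.1 + 1) p.2 - Ring.choose p.1 p.2) • t p)
      (Function.injective_id.prodMap (add_left_injective 1))]
    · simp [Ring.choose_succ_succ, Prod.map]
    · rintro ⟨j, _ | i⟩ hp
      · simp at hp
      · exact ⟨(j, i), rfl⟩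
  rw [shift, ← finsum_add_distrib (ht.subset fun p hp h => hp (by simp [h]))
    (ht.subset fun p hp h => hp (by simp [h]))]
  simp only [sub_smul, add_sub_cancel]

namespace PsiDO

variable {K : Type*} [Field K]

theorem ext {A B : PsiDO K} (h : ∀ n, A.coeff n = B.coeff n) : A = B := Subtype.ext (funext h)

theorem coeff_zero (n : ℤ) : (0 : PsiDO K).coeff n = 0 := rfl

theorem coeff_add (A B : PsiDO K) (n : ℤ) : (A + B).coeff n = A.coeff n + B.coeff n := rfl

theorem coeff_sub (A B : PsiDO K) (n : ℤ) : (A - B).coeff n = A.coeff n - B.coeff n := rfl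

theorem coeff_single (j : ℤ) (f : K) (n : ℤ) :
    (single j f).coeff n = if n = j then f else 0 := rfl

theorem single_zero (k : ℤ) : single k (0 : K) = 0 :=
  ext fun n => by rw [coeff_single, ite_self, coeff_zero]

variable (K) in
/-- The formal series `∑_{j ≤ m} rⱼ D_xʲ` for a fixed `m`, which filter `PsiDO K`. -/
def orderLE (m : ℤ) : AddSubgroup (PsiDO K) where
  carrier := {A | ∀ j, m < j → A.coeff j = 0}
  zero_mem' _ _ := rfl
  add_mem' hA hB j hj := by rw [coeff_add, hA j hj, hB j hj, add_zero]
  neg_mem' {A} hA j hj := by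
    change -A.coeff j = 0
    rw [hA j hj, neg_zero]

theorem exists_mem_orderLE (A : PsiDO K) : ∃ m, A ∈ orderLE K m := A.2

theorem coeff_sum_single (A : PsiDO K) (s : Finset ℤ) (n : ℤ) :
    (∑ j ∈ s, single j (A.coeff j)).coeff n = if n ∈ s then A.coeff n else 0 := by
  have h := map_sum (AddMonoidHom.mk' (fun B : PsiDO K => B.coeff n) fun A B => coeff_add A B n)
    (fun j => single j (A.coeff j)) s
  simp only [AddMonoidHom.mk'_apply, coeff_single] at h
  rw [h, Finset.sum_ite_eq]

theorem hom_ext_of_orderLE {M : Type*} [AddCommGroup M] {φ ψ : PsiDO K →+ M} (N : ℤ)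
    (hN : ∀ A ∈ orderLE K N, φ A = ψ A) (h : ∀ j f, φ (single j f) = ψ (single j f)) :
    φ = ψ := by
  ext A
  obtain ⟨m, hm⟩ := A.exists_mem_orderLE
  have hA : A - ∑ j ∈ Finset.Ioc N m, single j (A.coeff j) ∈ orderLE K N := fun j hj => by
    rw [coeff_sub, coeff_sum_single]
    split_ifs with hj'
    · exact sub_self _
    · rw [sub_zero, hm j (by simp only [Finset.mem_Ioc] at hj'; omega)]
  rw [← sub_add_cancel A (∑ j ∈ Finset.Ioc N m, single j (A.coeff j)), map_add, map_add, hN _ hA,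
    map_sum, map_sum, Finset.sum_congr rfl fun j _ => h j _]

/-- A derivation of `K` applied to a formal series coefficient by coefficient. -/
def mapCoeff (d : Derivation ℤ K K) : PsiDO K →+ PsiDO K :=
  AddMonoidHom.mk'
    (fun A => ⟨fun j => d (A.coeff j), by
      obtain ⟨m, hm⟩ := A.2
      exact ⟨m, fun j hj => by simp [coeff, hm j hj]⟩⟩)
    fun A B => ext fun n => map_add d (A.coeff n) (B.coeff n)

theorem coeff_mapCoeff (d : Derivation ℤ K K) (A : PsiDO K) (n : ℤ) :
    (mapCoeff d A).coeff n = d (A.coeff n) := rfl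

theorem mapCoeff_single (d : Derivation ℤ K K) (k : ℤ) (f : K) :
    mapCoeff d (single k f) = single k (d f) := ext fun n => by
  simp only [coeff_mapCoeff, coeff_single, apply_ite d, map_zero]

variable [JetField K]

theorem coeff_mul (A B : PsiDO K) (n : ℤ) : (A * B).coeff n = ∑ᶠ p : ℤ × ℕ,
    (Ring.choose p.1 p.2 : ℤ) • (A.coeff p.1 * Dx^[p.2] (B.coeff (n - p.1 + p.2))) := rfl

theorem mul_mem_orderLE {A B : PsiDO K} {a b : ℤ} (hA : A ∈ orderLE K a) (hB : B ∈ orderLE K b) :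
    A * B ∈ orderLE K (a + b) := fun n hn => by
  rw [coeff_mul, ← finsum_zero (α := ℤ × ℕ)]
  refine finsum_congr fun p => ?_
  rcases lt_or_ge a p.1 with h | h
  · rw [hA _ h, zero_mul, smul_zero]
  · rw [hB _ (by omega), iterate_Dx_zero, mul_zero, smul_zero]

theorem coe_mapCoeff_prolongation (Q : K) : ⇑(mapCoeff (prolongation Q)) = prolong Q := rfl

theorem mapCoeff_mul {d : Derivation ℤ K K} (hd : ∀ f, d (Dx f) = Dx (d f)) (A B : PsiDO K) :
    mapCoeff d (A * B) = mapCoeff d A * B + A * mapCoeff d B := ext fun n => by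
  rw [coeff_add, coeff_mul, coeff_mul, ← finsum_add_distrib (finite_support_mul _ _ n)
    (finite_support_mul _ _ n), coeff_mapCoeff, coeff_mul]
  refine (AddMonoidHom.map_finsum (d : K →+ K) (finite_support_mul A B n)).trans
    (finsum_congr fun p => ?_)
  have hd' := (Function.Semiconj.iterate_right (f := d) hd p.2) (B.coeff (n - p.1 + p.2))
  change d (_ • _) = _
  rw [map_zsmul, Derivation.leibniz, hd', coeff_mapCoeff, coeff_mapCoeff]
  simp only [smul_eq_mul]
  rw [← smul_add, mul_comm (d _), add_comm]

scoped instance : NonUnitalNonAssocRing (PsiDO K) where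
  left_distrib A B C := ext fun n => by
    rw [coeff_add]
    simp only [coeff_mul]
    rw [← finsum_add_distrib (finite_support_mul A B n) (finite_support_mul A C n)]
    exact finsum_congr fun p => by
      rw [coeff_add, ← coe_totalDerivation, iterate_map_add, mul_add, smul_add]
  right_distrib A B C := ext fun n => by
    rw [coeff_add]
    simp only [coeff_mul]
    rw [← finsum_add_distrib (finite_support_mul A C n) (finite_support_mul B C n)]
    exact finsum_congr fun p => by rw [coeff_add, add_mul, smul_add]
  zero_mul A := ext fun n => by simp [coeff_mul, coeff_zero]
  mul_zero A := ext fun n => by simp [coeff_mul, coeff_zero, iterate_Dx_zero]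

theorem coeff_single_zero_mul (f : K) (B : PsiDO K) (n : ℤ) :
    (single 0 f * B).coeff n = f * B.coeff n := by
  rw [coeff_mul, finsum_eq_single _ (0, 0)]
  · simp [coeff_single]
  · rintro ⟨j, i⟩ hp
    rcases eq_or_ne j 0 with rfl | hj
    · obtain ⟨k, rfl⟩ := Nat.exists_eq_add_one_of_ne_zero fun hi : i = 0 => hp (by rw [hi])
      simp
    · simp [coeff_single, hj]

theorem single_zero_mul_mul (f : K) (A B : PsiDO K) :
    single 0 f * A * B = single 0 f * (A * B) := ext fun n => by
  rw [coeff_single_zero_mul, coeff_mul, coeff_mul, mul_finsum' _ _ (finite_support_mul _ _ n)]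
  exact finsum_congr fun p => by rw [coeff_single_zero_mul, mul_assoc, mul_smul_comm]

theorem single_zero_mul_single (f g : K) (k : ℤ) :
    single 0 f * single k g = single k (f * g) := ext fun n => by
  simp only [coeff_single_zero_mul, coeff_single, mul_ite, mul_zero]

protected theorem one_mul (A : PsiDO K) : single 0 1 * A = A := ext fun n => by
  rw [coeff_single_zero_mul, one_mul]

theorem coeff_mul_single_one (A : PsiDO K) (k n : ℤ) :
    (A * single k 1).coeff n = A.coeff (n - k) := by
  rw [coeff_mul, finsum_eq_single _ (n - k, 0)]
  · simp [coeff_single]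
  · rintro ⟨j, _ | i⟩ hp
    · have : n - j ≠ k := fun h => hp (by rw [← h, sub_sub_cancel])
      simp [coeff_single, this]
    · have h₁ : Dx (1 : K) = 0 := (totalDerivation K).map_one_eq_zero
      rw [coeff_single]
      split_ifs <;> simp [Function.iterate_succ_apply, h₁, Dx_zero, iterate_Dx_zero]

theorem single_mul_single_one (j k : ℤ) (f : K) :
    single j f * single k 1 = single (j + k) f := ext fun n => by
  simp only [coeff_mul_single_one, coeff_single, sub_eq_iff_eq_add]

/-- The operator `D_x`. -/
def D : PsiDO K := single 1 1

theorem coeff_mul_D (A : PsiDO K) (n : ℤ) : (A * D).coeff n = A.coeff (n - 1) :=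
  coeff_mul_single_one A 1 n

theorem mul_mul_D (A B : PsiDO K) : A * B * D = A * (B * D) := ext fun n => by
  rw [coeff_mul_D, coeff_mul, coeff_mul]
  refine finsum_congr fun p => ?_
  rw [coeff_mul_D, show n - p.1 + p.2 - 1 = n - 1 - p.1 + p.2 by ring]

theorem finite_support_mul_iterate (A B : PsiDO K) (n : ℤ) : (Function.support fun p : ℤ × ℕ =>
    A.coeff p.1 * Dx^[p.2] (B.coeff (n - p.1 + p.2))).Finite := by
  obtain ⟨a, ha⟩ := A.exists_mem_orderLE
  obtain ⟨b, hb⟩ := B.exists_mem_orderLE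
  refine ((Set.finite_Icc (n - b) a).prod (Set.finite_Iic (b - n + a).toNat)).subset ?_
  rintro ⟨j, i⟩ hp
  have hj : j ≤ a := not_lt.mp fun h => left_ne_zero_of_mul hp (ha j h)
  have hi : n - j + i ≤ b := not_lt.mp fun h =>
    right_ne_zero_of_mul hp (by rw [hb _ h, iterate_Dx_zero])
  simp only [Set.mem_prod, Set.mem_Icc, Set.mem_Iic]
  omega

theorem mul_D_mul_eq_add (A B : PsiDO K) :
    A * D * B = A * B * D + A * mapCoeff (totalDerivation K) B := ext fun n => by
  let t : ℤ × ℕ → K := fun p => A.coeff p.1 * Dx^[p.2] (B.coeff (n - 1 - p.1 + p.2))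
  have left : (A * D * B).coeff n = ∑ᶠ p : ℤ × ℕ, Ring.choose (p.1 + 1) p.2 • t p := by
    rw [coeff_mul, ← finsum_comp_equiv ((Equiv.addRight (1 : ℤ)).prodCongr (Equiv.refl ℕ))]
    refine finsum_congr fun ⟨j, i⟩ => ?_
    simp only [Equiv.prodCongr_apply, Equiv.coe_addRight, Equiv.refl_apply, Prod.map_apply,
      coeff_mul_D, add_sub_cancel_right, t, sub_add_eq_sub_sub_swap]
  have right : (A * mapCoeff (totalDerivation K) B).coeff n =
      ∑ᶠ p : ℤ × ℕ, Ring.choose p.1 p.2 • t (p.1, p.2 + 1) := by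
    rw [coeff_mul]
    refine finsum_congr fun ⟨j, i⟩ => ?_
    simp only [t, coeff_mapCoeff, coe_totalDerivation, Function.iterate_succ_apply]
    rw [show n - 1 - j + (i + 1 : ℕ) = n - j + i by push_cast; ring]
  rw [coeff_add, coeff_mul_D, left, right,
    finsum_choose_succ_smul (finite_support_mul_iterate A B (n - 1)), coeff_mul]

theorem D_mul_eq_add (A : PsiDO K) : D * A = A * D + mapCoeff (totalDerivation K) A := by
  simpa only [PsiDO.one_mul] using mul_D_mul_eq_add (single 0 1) A

theorem mul_D_mul (A B : PsiDO K) : A * D * B = A * (D * B) := by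
  rw [D_mul_eq_add, mul_add, ← mul_mul_D, mul_D_mul_eq_add]

theorem D_mul_mul (A B : PsiDO K) : D * A * B = D * (A * B) := by
  rw [D_mul_eq_add, D_mul_eq_add, add_mul, mul_D_mul_eq_add,
    mapCoeff_mul (d := totalDerivation K) fun _ => rfl, add_assoc, add_comm (A * _)]

theorem D_mul_injective : Function.Injective fun A : PsiDO K => D * A := fun A B h => by
  have cancel : ∀ A : PsiDO K, single (-1) 1 * (D * A) = A := fun A => by
    rw [← mul_D_mul, D, single_mul_single_one, neg_add_cancel, PsiDO.one_mul]
  rw [← cancel A, ← cancel B]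
  exact congrArg _ h

theorem D_mul_single_one (k : ℤ) : D * single k 1 = single (k + 1) (1 : K) := by
  rw [D, single_mul_single_one, add_comm]

theorem single_one_mul_mul (k : ℤ) (A B : PsiDO K) :
    single k 1 * A * B = single k 1 * (A * B) := by
  induction k with
  | zero => rw [PsiDO.one_mul, PsiDO.one_mul]
  | succ k ih => rw [← D_mul_single_one, D_mul_mul, D_mul_mul, ih, D_mul_mul]
  | pred k ih =>
    apply D_mul_injective
    simpa only [← D_mul_mul, D_mul_single_one, sub_add_cancel] using ih

theorem single_mul_mul (k : ℤ) (f : K) (A B : PsiDO K) :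
    single k f * A * B = single k f * (A * B) := by
  rw [← mul_one f, ← single_zero_mul_single, single_zero_mul_mul, single_zero_mul_mul,
    single_one_mul_mul, ← single_zero_mul_mul]

protected theorem mul_assoc (A B C : PsiDO K) : A * B * C = A * (B * C) := ext fun n => by
  obtain ⟨b, hb⟩ := B.exists_mem_orderLE
  obtain ⟨c, hc⟩ := C.exists_mem_orderLE
  let φ : PsiDO K →+ K := AddMonoidHom.mk' (fun A => (A * B * C).coeff n) fun A A' => by
    rw [add_mul, add_mul, coeff_add]
  let ψ : PsiDO K →+ K := AddMonoidHom.mk' (fun A => (A * (B * C)).coeff n) fun A A' => by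
    rw [add_mul, coeff_add]
  -- Each coefficient of the two products depends on finitely many coefficients of `A` only, so it
  -- is enough to consider `A = f D_xʲ`.
  refine DFunLike.congr_fun (hom_ext_of_orderLE (φ := φ) (ψ := ψ) (n - b - c - 1)
    (fun A hA => ?_) fun j f => ?_) A
  · exact (mul_mem_orderLE (mul_mem_orderLE hA hb) hc n (by omega)).trans
      (mul_mem_orderLE hA (mul_mem_orderLE hb hc) n (by omega)).symm
  · exact congrArg (fun S => S.coeff n) (single_mul_mul j f B C)

scoped instance : Ring (PsiDO K) where
  __ : NonUnitalNonAssocRing (PsiDO K) := inferInstance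
  one := single 0 1
  mul_assoc := PsiDO.mul_assoc
  one_mul := PsiDO.one_mul
  mul_one A := ext fun n => by
    change (A * single 0 1).coeff n = _
    rw [coeff_mul_single_one, sub_zero]

theorem one_def : (1 : PsiDO K) = single 0 1 := rfl

variable (K) in
/-- The inclusion of functions as operators of multiplication. -/
def singleZeroHom : K →+* PsiDO K where
  toFun := single 0
  map_one' := rfl
  map_mul' f g := (single_zero_mul_single f g 0).symm
  map_zero' := single_zero 0
  map_add' f g := ext fun n => by
    simp only [coeff_add, coeff_single]
    split_ifs <;> simp

scoped instance : Module K (PsiDO K) := Module.compHom _ (singleZeroHom K)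

theorem smul_def (f : K) (A : PsiDO K) : f • A = single 0 f * A := rfl

scoped instance : IsScalarTower K (PsiDO K) (PsiDO K) where
  smul_assoc f A B := mul_assoc (single 0 f) A B

theorem single_eq_smul (k : ℤ) (f : K) : single k f = f • single k 1 := by
  rw [smul_def, single_zero_mul_single, mul_one]

theorem D_mul_smul (f : K) (A : PsiDO K) : D * f • A = f • (D * A) + Dx f • A := by
  rw [smul_def, ← mul_assoc, D_mul_eq_add, mapCoeff_single, add_mul, coe_totalDerivation, smul_def,
    smul_def, mul_assoc]

theorem single_two_one : single 2 (1 : K) = D * D := (single_mul_single_one 1 1 1).symm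

theorem single_neg_one_mul_D : single (-1) 1 * D = (1 : PsiDO K) := single_mul_single_one (-1) 1 1

theorem isUnit_D : IsUnit (D : PsiDO K) :=
  ⟨⟨D, single (-1) 1, single_mul_single_one 1 (-1) 1, single_neg_one_mul_D⟩, rfl⟩

theorem isUnit_smul_one {f : K} (hf : f ≠ 0) : IsUnit (f • (1 : PsiDO K)) := by
  rw [smul_def, mul_one]
  exact (isUnit_iff_ne_zero.mpr hf).map (singleZeroHom K)

/-! ### Formal recursion operators -/

variable {F : K}

theorem prolong_add (A B : PsiDO K) : prolong F (A + B) = prolong F A + prolong F B :=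
  map_add (mapCoeff (prolongation F)) A B

theorem prolong_mul (A B : PsiDO K) : prolong F (A * B) = prolong F A * B + A * prolong F B :=
  mapCoeff_mul (d := prolongation F) (prolong_Dx F) A B

theorem prolong_smul (f : K) (A : PsiDO K) :
    prolong F (f • A) = JetField.prolong F f • A + f • prolong F A := by
  rw [smul_def, prolong_mul, ← coe_mapCoeff_prolongation, mapCoeff_single]
  rfl

theorem prolong_single_one (k : ℤ) : prolong F (single k 1) = 0 := by
  rw [← coe_mapCoeff_prolongation, mapCoeff_single, Derivation.map_one_eq_zero]
  exact single_zero k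

theorem isFormalRecursionOperator_of_mul_eq_mul {P T M : PsiDO K} (hT : IsUnit T)
    (hPT : P * T = T * M) (hprT : prolong F T = frechet F * T - T * T)
    (hprM : prolong F M = T * M - M * T) : IsFormalRecursionOperator F P := by
  rw [IsFormalRecursionOperator, sub_eq_zero]
  apply hT.mul_left_injective
  have h : prolong F P * T + P * prolong F T = prolong F T * M + T * prolong F M := by
    rw [← prolong_mul, hPT, prolong_mul]
  calc prolong F P * T
      = prolong F T * M + T * prolong F M - P * prolong F T := by rw [← h, add_sub_cancel_right]
    _ = frechet F * (T * M) - (T * M) * T - (P * frechet F - P * T) * T := by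
        rw [hprT, hprM]
        noncomm_ring
    _ = (frechet F * P - P * frechet F) * T := by
        rw [← hPT]
        noncomm_ring

end PsiDO

/-! ### Operators in `D_x` and `D_t` -/

namespace EvolOp

variable {K : Type*} [Field K] {F : K}

theorem single_zero (l : ℕ) : single F l 0 = 0 := Finsupp.single_zero l

theorem single_sub (l : ℕ) (A B : PsiDO K) :
    single F l (A - B) = single F l A - single F l B := Finsupp.single_sub l A B

variable [JetField K]

open scoped PsiDO

theorem iterate_prolong_zero (Q : K) (p : ℕ) : (PsiDO.prolong Q)^[p] 0 = 0 :=
  iterate_map_zero (PsiDO.mapCoeff (prolongation Q)) p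

theorem iterate_prolong_sub (Q : K) (p : ℕ) (A B : PsiDO K) :
    (PsiDO.prolong Q)^[p] (A - B) = (PsiDO.prolong Q)^[p] A - (PsiDO.prolong Q)^[p] B :=
  iterate_map_sub (PsiDO.mapCoeff (prolongation Q)) p A B

theorem mul_def (A B : EvolOp F) : A * B =
    Finsupp.sum A fun l a => Finsupp.sum B fun k b => ∑ p ∈ Finset.range (l + 1),
      single F (l + k - p) (l.choose p • (a * (PsiDO.prolong F)^[p] b)) := rfl

protected theorem sub_mul (A B C : EvolOp F) : (A - B) * C = A * C - B * C := by
  simp only [mul_def]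
  refine Finsupp.sum_sub_index fun l a b => ?_
  refine Eq.trans (Finsupp.sum_congr fun k _ => ?_) (Finsupp.sum_sub (f := C))
  simp only [sub_mul, smul_sub, single_sub, Finset.sum_sub_distrib]

protected theorem mul_sub (A B C : EvolOp F) : A * (B - C) = A * B - A * C := by
  simp only [mul_def]
  refine Eq.trans (Finsupp.sum_congr fun l _ => ?_) (Finsupp.sum_sub (f := A))
  refine Finsupp.sum_sub_index fun k b c => ?_
  simp only [iterate_prolong_sub, mul_sub, smul_sub, single_sub, Finset.sum_sub_distrib]

theorem single_mul_single (l k : ℕ) (A B : PsiDO K) : single F l A * single F k B =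
    ∑ p ∈ Finset.range (l + 1),
      single F (l + k - p) (l.choose p • (A * (PsiDO.prolong F)^[p] B)) := by
  rw [mul_def]
  refine (Finsupp.sum_single_index ?_).trans (Finsupp.sum_single_index ?_)
  · refine Finset.sum_eq_zero fun k _ => Finset.sum_eq_zero fun _ _ => ?_
    simp only [zero_mul, smul_zero, single_zero]
  · refine Finset.sum_eq_zero fun _ _ => ?_
    simp only [iterate_prolong_zero, mul_zero, smul_zero, single_zero]

theorem Dt_mul_ofPsiDO (A : PsiDO K) :
    Dt F * ofPsiDO F A = ofPsiDO F (PsiDO.prolong F A) + single F 1 A := by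
  rw [Dt, ofPsiDO, single_mul_single]
  simp [Finset.sum_range_succ, ← PsiDO.one_def, ofPsiDO, add_comm]

theorem ofPsiDO_mul_Dt (A : PsiDO K) : ofPsiDO F A * Dt F = single F 1 A := by
  rw [Dt, ofPsiDO, single_mul_single]
  simp [← PsiDO.one_def]

theorem ofPsiDO_mul_ofPsiDO (A B : PsiDO K) :
    ofPsiDO F A * ofPsiDO F B = ofPsiDO F (A * B) := by
  rw [ofPsiDO, ofPsiDO, single_mul_single]
  simp [ofPsiDO]

theorem linearization_mul_ofPsiDO_sub (S : PsiDO K) :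
    linearization F * ofPsiDO F S - ofPsiDO F S * linearization F =
      ofPsiDO F (PsiDO.prolong F S - (PsiDO.frechet F * S - S * PsiDO.frechet F)) := by
  rw [linearization, EvolOp.sub_mul, EvolOp.mul_sub, Dt_mul_ofPsiDO, ofPsiDO_mul_Dt,
    ofPsiDO_mul_ofPsiDO, ofPsiDO_mul_ofPsiDO]
  simp only [ofPsiDO, single_sub]
  abel

theorem linearization_mul_ofPsiDO_comm_iff {S : PsiDO K} :
    linearization F * ofPsiDO F S = ofPsiDO F S * linearization F ↔
      PsiDO.IsFormalRecursionOperator F S := by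
  rw [← sub_eq_zero, linearization_mul_ofPsiDO_sub]
  exact Finsupp.single_eq_zero

end EvolOp

theorem derivation_div_two {R K : Type*} [CommRing R] [Field K] [Algebra R K]
    (d : Derivation R K K) (f : K) : d (f / 2) = d f / 2 := by
  rw [d.leibniz_div_const f 2 (by exact_mod_cast d.map_natCast 2), smul_eq_mul, div_eq_inv_mul]

theorem NonlocalOp.IsRecursionOperator.exists_seq {K : Type*} [Field K] [JetField K] {F Q₁ : K}
    {R : NonlocalOp K} (h : R.IsRecursionOperator F Q₁) :
    ∃ Q : ℕ → K, Q 0 = Q₁ ∧ (∀ j, R.Applies (Q j) (Q (j + 1))) ∧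
      ∀ j, R.IsIterate Q₁ j (Q j) := by
  choose! next hnext using fun Q (hQ : ∃ n, R.IsIterate Q₁ n Q) => (h _ Q hQ.choose_spec).2
  have hQ : ∀ j, R.IsIterate Q₁ j (next^[j] Q₁) := fun j => by
    induction j with
    | zero => exact .root
    | succ j ih => exact Function.iterate_succ_apply' next j Q₁ ▸ ih.step (hnext _ ⟨j, ih⟩)
  exact ⟨fun j => next^[j] Q₁, rfl,
    fun j => by simpa only [Function.iterate_succ_apply'] using hnext _ ⟨j, hQ j⟩, hQ⟩

section Equation

variable {K : Type*} [Field K] [JetField K]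

/-! ### The equation `u_t = u² (1 + u₂)` -/

theorem du_rhs (j : ℕ) : du j (rhs K) =
    (if j = 2 then u 0 ^ 2 else 0) + if j = 0 then 2 * u 0 * (1 + u 2) else 0 := by
  simp only [rhs, pow_two, Derivation.leibniz, map_add, Derivation.map_one_eq_zero, du_u,
    smul_eq_mul]
  split_ifs <;> ring

theorem frechetApply_rhs (v : K) :
    frechetApply (rhs K) v = u 0 ^ 2 * Dx (Dx v) + 2 * u 0 * (1 + u 2) * v := by
  rw [frechetApply, finsum_eq_sum_of_support_subset (s := Finset.range 3) _ fun i hi => by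
    by_contra h
    simp only [Finset.coe_range, Set.mem_Iio, not_lt] at h
    exact hi (by simp [du_rhs, show i ≠ 2 by omega, show i ≠ 0 by omega])]
  simp only [du_rhs, Finset.sum_range_succ, Finset.range_one, Finset.sum_singleton,
    OfNat.zero_ne_ofNat, ↓reduceIte, zero_add, Function.iterate_zero, id_eq, OfNat.one_ne_ofNat,
    one_ne_zero, add_zero, zero_mul, OfNat.ofNat_ne_zero,
    Function.iterate_succ, Function.comp_apply]
  ring

/-- `B` is a potential of `Q`: it solves the linear equation `D_t B = u² D_x² B`, and `Q` is
the common value of the two sides. Such a `Q` is a symmetry. -/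
structure IsPotential (B Q : K) : Prop where
  prolong_eq : prolong (rhs K) B = Q
  mul_Dx_Dx : u 0 ^ 2 * Dx (Dx B) = Q

namespace IsPotential

variable {B B' Q Q' : K}

theorem isSymmetry (h : IsPotential B Q) : IsSymmetry (rhs K) Q := by
  have hQ : prolong (rhs K) Q =
      u 0 ^ 2 * Dx (Dx Q) + 2 * u 0 * rhs K * Dx (Dx B) := by
    rw [← h.mul_Dx_Dx, ← coe_prolongation, Derivation.leibniz, Derivation.leibniz_pow,
      prolongation_u, coe_prolongation, prolong_Dx, prolong_Dx, h.prolong_eq, ← h.mul_Dx_Dx]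
    simp only [smul_eq_mul, nsmul_eq_mul, Function.iterate_zero_apply, Nat.cast_ofNat]
    ring
  rw [IsSymmetry, frechetApply_rhs, hQ, rhs, ← h.mul_Dx_Dx]
  ring

theorem hasOrder {n : ℕ} (h : IsPotential B Q) (hB : HasOrder B n) : HasOrder Q (n + 2) :=
  h.mul_Dx_Dx ▸ hB.Dx.Dx.mul_left (pow_mem (u_mem_orderLT (by omega)) 2)
    (pow_ne_zero 2 u_zero_ne_zero)

theorem Dx_Dx_eq (h : IsPotential B Q) : Dx (Dx B) = (recOp K).b * Q := by
  rw [recOp, one_div, ← h.mul_Dx_Dx, inv_mul_cancel_left₀ (pow_ne_zero 2 u_zero_ne_zero)]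

theorem applies (h : IsPotential B Q) :
    (recOp K).Applies Q (u 0 * Dx Q + x / 2 * Q + u 0 ^ 2 * (1 + u 2) * Dx B) :=
  ⟨Dx B, h.Dx_Dx_eq, rfl⟩

theorem add (h : IsPotential B Q) (h' : IsPotential B' Q') : IsPotential (B + B') (Q + Q') where
  prolong_eq := by
    rw [← h.prolong_eq, ← h'.prolong_eq]
    exact map_add (prolongation (rhs K)) B B'
  mul_Dx_Dx := by
    rw [← h.mul_Dx_Dx, ← h'.mul_Dx_Dx]
    simp only [← coe_totalDerivation, map_add, mul_add]

theorem const_mul (h : IsPotential B Q) {c : K} (hc : Dx c = 0) : IsPotential (c * B) (c * Q) where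
  prolong_eq := by
    rw [← coe_prolongation, Derivation.leibniz, coe_prolongation, h.prolong_eq,
      prolong_eq_zero_of_mem_orderLT_zero _ (mem_orderLT_zero_of_Dx_eq_zero hc), smul_zero,
      add_zero, smul_eq_mul]
  mul_Dx_Dx := by
    rw [← h.mul_Dx_Dx]
    simp only [← coe_totalDerivation] at hc ⊢
    simp only [Derivation.leibniz, hc, mul_zero, add_zero, smul_eq_mul]
    ring

end IsPotential

variable (K) in
/-- The potential `u + x² / 2` of the root `C₄`. -/
def rootPotential : K := u 0 + x ^ 2 / 2

theorem hasOrder_rootPotential : HasOrder (rootPotential K) 0 := by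
  have h : ∀ m, du m (rootPotential K) = if m = 0 then 1 else 0 := fun m => by
    rw [rootPotential, map_add, du_u, derivation_div_two, Derivation.leibniz_pow, du_x]
    simp
  exact ⟨by simp [h], fun m hm => by simp [h, hm.ne']⟩

/-- The operator `u D_x + x / 2`, which acts on potentials as `recOp` does on symmetries. -/
def potentialStep (B : K) : K := u 0 * Dx B + x / 2 * B

theorem HasOrder.potentialStep {B : K} {n : ℕ} (hB : HasOrder B n) :
    HasOrder (potentialStep B) (n + 1) :=
  (hB.Dx.mul_left (u_mem_orderLT n.succ_pos) u_zero_ne_zero).add <|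
    mul_mem (div_mem (x_mem_orderLT _) (ofNat_mem _ 2)) (hB.mem_orderLT n.lt_succ_self)

section Recursion

variable [NeZero (2 : K)]

theorem Dx_rootPotential : Dx (rootPotential K) = u 1 + x := by
  have h₂ : (2 : K) ≠ 0 := two_ne_zero
  rw [rootPotential, ← coe_totalDerivation, map_add, derivation_div_two, Derivation.leibniz_pow,
    totalDerivation_u, totalDerivation_x]
  simp only [nsmul_eq_mul, smul_eq_mul, Nat.cast_ofNat]
  field_simp
  ring

theorem isPotential_C₄ : IsPotential (rootPotential K) (C₄ K) where
  prolong_eq := by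
    rw [rootPotential, ← coe_prolongation, map_add, derivation_div_two, Derivation.leibniz_pow,
      prolongation_u, prolongation_x]
    simp [rhs, C₄]
  mul_Dx_Dx := by
    rw [Dx_rootPotential, ← coe_totalDerivation, map_add, totalDerivation_u, totalDerivation_x,
      C₄, add_comm]

theorem IsPotential.potentialStep {B Q : K} (h : IsPotential B Q) :
    IsPotential (potentialStep B) (u 0 * Dx Q + x / 2 * Q + rhs K * Dx B) where
  prolong_eq := by
    rw [JetField.potentialStep, ← coe_prolongation, map_add, Derivation.leibniz,
      Derivation.leibniz, derivation_div_two, prolongation_u, prolongation_x, coe_prolongation,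
      prolong_Dx, h.prolong_eq]
    simp only [smul_eq_mul, Function.iterate_zero_apply]
    ring
  mul_Dx_Dx := by
    have h₂ : (2 : K) ≠ 0 := two_ne_zero
    rw [JetField.potentialStep, ← h.mul_Dx_Dx, rhs]
    simp only [← coe_totalDerivation, map_add, Derivation.leibniz, Derivation.leibniz_pow,
      derivation_div_two, totalDerivation_u, totalDerivation_x, Derivation.map_one_eq_zero,
      smul_eq_mul, nsmul_eq_mul, Nat.cast_ofNat]
    field_simp
    ring

theorem IsPotential.exists_of_applies {B Q Q' : K} {n : ℕ} (h : IsPotential B Q)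
    (hB : HasOrder B n) (hQ' : (recOp K).Applies Q Q') :
    ∃ B', IsPotential B' Q' ∧ HasOrder B' (n + 1) := by
  obtain ⟨k, hk, rfl⟩ := hQ'
  have hc : Dx (k - Dx B) = 0 := by
    rw [← coe_totalDerivation, map_sub, coe_totalDerivation, hk, h.Dx_Dx_eq, sub_self]
  refine ⟨JetField.potentialStep B + (k - Dx B) * rootPotential K, ?_, hB.potentialStep.add <|
    mul_mem (orderLT_mono n.succ.zero_le (mem_orderLT_zero_of_Dx_eq_zero hc))
      (hasOrder_rootPotential.mem_orderLT n.succ_pos)⟩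
  convert h.potentialStep.add (isPotential_C₄.const_mul hc) using 1
  simp only [recOp, rhs, C₄]
  ring

theorem exists_isPotential_of_isIterate {n : ℕ} {Q : K} (h : (recOp K).IsIterate (C₄ K) n Q) :
    ∃ B, IsPotential B Q ∧ HasOrder B n := by
  induction h with
  | root => exact ⟨_, isPotential_C₄, hasOrder_rootPotential⟩
  | step _ hQ' ih =>
    obtain ⟨B, hB, hn⟩ := ih
    exact hB.exists_of_applies hn hQ'

theorem isRecursionOperator_recOp : (recOp K).IsRecursionOperator (rhs K) (C₄ K) := fun _ _ hQ =>
  let ⟨_, hB, _⟩ := exists_isPotential_of_isIterate hQ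
  ⟨hB.isSymmetry, _, hB.applies⟩

theorem hasOrder_of_isIterate {n : ℕ} {Q : K} (hQ : (recOp K).IsIterate (C₄ K) n Q) :
    HasOrder Q (n + 2) :=
  let ⟨_, hB, hn⟩ := exists_isPotential_of_isIterate hQ
  hB.hasOrder hn

theorem applies_C₄_C₃ : (recOp K).Applies (C₄ K) (C₃ K) := by
  have h₂ : (2 : K) ≠ 0 := two_ne_zero
  convert (isPotential_C₄ (K := K)).applies using 1
  rw [Dx_rootPotential, C₃, C₄]
  simp only [← coe_totalDerivation, map_add, Derivation.leibniz, Derivation.leibniz_pow,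
    totalDerivation_u, Derivation.map_one_eq_zero, smul_eq_mul, nsmul_eq_mul, Nat.cast_ofNat]
  field_simp
  ring

end Recursion

end Equation

namespace PsiDO

variable {K : Type*} [Field K] [JetField K]

variable (K) in
theorem frechet_rhs :
    frechet (rhs K) = single 2 (u 0 ^ 2) + single 0 (2 * u 0 * (1 + u 2)) := ext fun n => by
  change (if 0 ≤ n then du n.toNat (rhs K) else 0) = _
  rw [coeff_add, coeff_single, coeff_single]
  rcases lt_or_ge n 0 with hn | hn
  · rw [if_neg (by omega), if_neg (by omega), if_neg (by omega), add_zero]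
  · lift n to ℕ using hn
    rw [if_pos (by omega), Int.toNat_natCast, du_rhs]
    norm_cast

variable (K) in
/-- The operator `u² D_x²`, which takes potentials to symmetries. -/
def heatOp : PsiDO K := (u 0 ^ 2 : K) • (D * D : PsiDO K)

variable (K) in
/-- The operator `potentialStep` as a formal series. -/
def potentialOp : PsiDO K := (u 0 : K) • (D : PsiDO K) + (x / 2 : K) • (1 : PsiDO K)

theorem isUnit_heatOp : IsUnit (heatOp K) := by
  rw [heatOp, ← one_mul (D * D), ← smul_mul_assoc]
  exact (isUnit_smul_one (pow_ne_zero 2 u_zero_ne_zero)).mul (isUnit_D.mul isUnit_D)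

theorem frechet_rhs_eq_heatOp_add :
    frechet (rhs K) = heatOp K + (2 * u 0 * (1 + u 2) : K) • (1 : PsiDO K) := by
  rw [frechet_rhs, single_eq_smul, single_two_one, heatOp, smul_def (_ * _), mul_one]

theorem prolong_heatOp :
    prolong (rhs K) (heatOp K) = frechet (rhs K) * heatOp K - heatOp K * heatOp K := by
  rw [frechet_rhs_eq_heatOp_add, add_mul, add_sub_cancel_left, smul_mul_assoc, one_mul, heatOp,
    prolong_smul, ← single_two_one, prolong_single_one, smul_zero, add_zero, ← coe_prolongation,
    Derivation.leibniz_pow, prolongation_u, smul_smul]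
  simp only [rhs, Function.iterate_zero_apply, nsmul_eq_mul, smul_eq_mul]
  module

theorem heatOp_mul_potentialOp_sub [NeZero (2 : K)] :
    heatOp K * potentialOp K - potentialOp K * heatOp K = rhs K • (D : PsiDO K) := by
  have hx : Dx (x / 2 : K) = 1 / 2 := by
    rw [← coe_totalDerivation, derivation_div_two, totalDerivation_x]
  have hc : Dx (1 / 2 : K) = 0 := by
    rw [← coe_totalDerivation, derivation_div_two, Derivation.map_one_eq_zero, zero_div]
  have hu (i : ℕ) : Dx (u i : K) = u (i + 1) := totalDerivation_u i
  have hsq : Dx (u 0 ^ 2 : K) = 2 * u 0 * u 1 := by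
    rw [← coe_totalDerivation, Derivation.leibniz_pow, totalDerivation_u]
    simp only [nsmul_eq_mul, smul_eq_mul]
    ring
  have hDDM : D * (D * potentialOp K) = (u 0 : K) • (D * (D * D)) +
      (2 * u 1 + x / 2 : K) • (D * D) + (1 + u 2 : K) • (D : PsiDO K) := by
    simp only [potentialOp, mul_add, D_mul_smul, hx, hc, hu, mul_one]
    match_scalars <;> field_simp <;> ring
  have hMT : potentialOp K * heatOp K = (u 0 ^ 3 : K) • (D * (D * D)) +
      (u 0 ^ 2 * (2 * u 1 + x / 2) : K) • (D * D) := by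
    simp only [potentialOp, heatOp, add_mul, smul_mul_assoc, D_mul_smul, one_mul, hsq]
    module
  rw [hMT, heatOp, smul_mul_assoc, mul_assoc, hDDM, rhs]
  module

theorem recOp_mul_heatOp [NeZero (2 : K)] :
    (recOp K).toPsiDO * heatOp K = heatOp K * potentialOp K := by
  have hP : (recOp K).toPsiDO = potentialOp K +
      single 0 (rhs K) * single (-1) 1 * single 0 (1 / u 0 ^ 2) := by
    rw [NonlocalOp.toPsiDO, single_eq_smul 1, single_eq_smul 0 (recOp K).c₀]
    rfl
  have hcancel : single 0 (1 / u 0 ^ 2) * heatOp K = D * D := by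
    rw [heatOp, ← smul_def, smul_smul, one_div_mul_cancel (pow_ne_zero 2 u_zero_ne_zero), one_smul]
  have hnonlocal : single 0 (rhs K) * single (-1) 1 * single 0 (1 / u 0 ^ 2) * heatOp K =
      rhs K • (D : PsiDO K) := by
    rw [mul_assoc, hcancel, mul_assoc, ← mul_assoc (single (-1) 1), single_neg_one_mul_D, one_mul,
      smul_def]
  rw [hP, add_mul, hnonlocal, ← heatOp_mul_potentialOp_sub, add_sub_cancel]

theorem prolong_potentialOp [NeZero (2 : K)] :
    prolong (rhs K) (potentialOp K) = heatOp K * potentialOp K - potentialOp K * heatOp K := by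
  have hu : JetField.prolong (rhs K) (u 0) = rhs K := prolongation_u (rhs K) 0
  have hx : JetField.prolong (rhs K) (x / 2) = 0 := by
    rw [← coe_prolongation, derivation_div_two, prolongation_x, zero_div]
  rw [heatOp_mul_potentialOp_sub, potentialOp, prolong_add, prolong_smul, prolong_smul, hu, hx, D,
    prolong_single_one, one_def, prolong_single_one, smul_zero, smul_zero, zero_smul, add_zero,
    add_zero, add_zero]

theorem isFormalRecursionOperator_recOp [NeZero (2 : K)] :
    IsFormalRecursionOperator (rhs K) (recOp K).toPsiDO :=
  isFormalRecursionOperator_of_mul_eq_mul isUnit_heatOp recOp_mul_heatOp prolong_heatOp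
    prolong_potentialOp

end PsiDO

end JetField

end

open JetField in
theorem mainTheorem4_general (K : Type*) [Field K] [NeZero (2 : K)] [JetField K] :
    (EvolOp.linearization (rhs K) = EvolOp.Dt (rhs K) - EvolOp.ofPsiDO (rhs K)
      (PsiDO.single 2 (u 0 ^ 2) + PsiDO.single 0 (2 * u 0 * (1 + u 2)))) ∧
    (EvolOp.linearization (rhs K) * EvolOp.ofPsiDO (rhs K) (recOp K).toPsiDO =
      EvolOp.ofPsiDO (rhs K) (recOp K).toPsiDO * EvolOp.linearization (rhs K)) ∧
    PsiDO.IsFormalRecursionOperator (rhs K) (recOp K).toPsiDO ∧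
    (recOp K).IsRecursionOperator (rhs K) (C₄ K) ∧
    (∀ n Q, (recOp K).IsIterate (C₄ K) n Q → HasOrder Q (n + 2)) ∧
    (∃ Q : ℕ → K, Q 0 = C₄ K ∧ (∀ j, (recOp K).Applies (Q j) (Q (j + 1))) ∧
      ∀ j, IsSymmetry (rhs K) (Q j) ∧ HasOrder (Q j) (j + 2)) ∧
    (recOp K).Applies (C₄ K) (C₃ K) ∧
    HasOrder (C₄ K) 2 ∧ HasOrder (C₃ K) 3 := by
  have hP := PsiDO.isFormalRecursionOperator_recOp (K := K)
  have hrec := isRecursionOperator_recOp (K := K)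
  have hroot : (recOp K).IsIterate (C₄ K) 0 (C₄ K) := .root
  obtain ⟨Q, hQ₀, hQ, hiter⟩ := hrec.exists_seq
  refine ⟨?_, EvolOp.linearization_mul_ofPsiDO_comm_iff.mpr hP, hP, hrec,
    fun _ _ => hasOrder_of_isIterate,
    ⟨Q, hQ₀, hQ, fun j => ⟨(hrec j _ (hiter j)).1, hasOrder_of_isIterate (hiter j)⟩⟩,
    applies_C₄_C₃, hasOrder_of_isIterate hroot,
    hasOrder_of_isIterate (hroot.step applies_C₄_C₃)⟩
  rw [EvolOp.linearization, PsiDO.frechet_rhs]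

theorem mainTheorem4 (K : Type*) [Field K] [CharZero K] [JetField K] :
    -- the Fréchet derivative of the equation is `D_t - u² D_x² - 2 u (1 + u₂)`
    (JetField.EvolOp.linearization (JetField.rhs K) =
      JetField.EvolOp.Dt (JetField.rhs K) -
        JetField.EvolOp.ofPsiDO (JetField.rhs K)
          (JetField.PsiDO.single 2 (JetField.u 0 ^ 2) +
            JetField.PsiDO.single 0 (2 * JetField.u 0 * (1 + JetField.u 2)))) ∧
    -- it commutes with `P`
    (JetField.EvolOp.linearization (JetField.rhs K) *
        JetField.EvolOp.ofPsiDO (JetField.rhs K) (JetField.recOp K).toPsiDO =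
      JetField.EvolOp.ofPsiDO (JetField.rhs K) (JetField.recOp K).toPsiDO *
        JetField.EvolOp.linearization (JetField.rhs K)) ∧
    -- `P` is a formal recursion operator
    JetField.PsiDO.IsFormalRecursionOperator (JetField.rhs K) (JetField.recOp K).toPsiDO ∧
    -- `P` is a recursion operator with root `C₄ = u² (1 + u₂)`
    (JetField.recOp K).IsRecursionOperator (JetField.rhs K) (JetField.C₄ K) ∧
    -- the symmetries generated by `P` from the root are of strictly increasing order
    (∀ n Q, (JetField.recOp K).IsIterate (JetField.C₄ K) n Q → JetField.HasOrder Q (n + 2)) ∧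
    (∃ Q : ℕ → K, Q 0 = JetField.C₄ K ∧ (∀ j, (JetField.recOp K).Applies (Q j) (Q (j + 1))) ∧
      ∀ j, JetField.IsSymmetry (JetField.rhs K) (Q j) ∧ JetField.HasOrder (Q j) (j + 2)) ∧
    -- `P C₄ = C₃`, of orders 2 and 3
    (JetField.recOp K).Applies (JetField.C₄ K) (JetField.C₃ K) ∧
    JetField.HasOrder (JetField.C₄ K) 2 ∧ JetField.HasOrder (JetField.C₃ K) 3 :=
  mainTheorem4_general K
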